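/- Let $n\ge 0$, $p\in[1,\infty]$ and $\frac1p+\frac1{p'}=1$ (also $\frac1q+\frac1{q'}=1$ below). For $g\in L^{r}(\mathbb R^n)$ with $r\in[1,\infty]$, let $\widehat g$ be its distributional Fourier transform, $\langle\widehat g,\psi\rangle=\int g\,\widehat\psi\,dx$ for all Schwartz functions $\psi$, where $\widehat\psi(y)=\int\psi(x)e^{-2\pi i x\cdot y}dx$. For $q\in[1,\infty]$ let $$\widehat L^{q}(\mathbb R^n)=\{f\in L^{q}(\mathbb R^n):\ f=\widehat g\text{ for some }g\in L^{q'}(\mathbb R^n)\},\qquad \|f\|_{\widehat L^{q}}=\|\widehat f\,\|_{L^{q'}}.$$ Let $\mathcal M$ be the complex vector space of sigma-finite complex Borel measures on $\mathbb R^n$, that is, of all $d\mu=\varphi\,d|\mu|$ with $|\mu|$ a sigma-finite positive Borel measure (possibly infinite) and $\varphi$ a Borel function with $|\varphi|=1$, where $\varphi$ is determined up to $|\mu|$-null sets and measures are added by adding densities with respect to a common sigma-finite positive measure. For $\mu\in\mathcal M$ put $$\|\mu\|_p^*=\sup\Big\{\Big|\int_{\mathbb R^n}h\,d\mu\Big|\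 :\ h\in\widehat L^{p'}(\mathbb R^n)\text{ continuous},\ \|h\|_{\widehat L^{p'}}\le 1\Big\}\in[0,\infty],$$ where $\left|\int h\,d\mu\right|$ is read as $\infty$ if $h$ is not $|\mu|$-integrable, and let $\mathcal M_p=\{\mu\in\mathcal M:\|\mu\|_p^*<\infty\}$. Then $\mathcal M_p$ is a linear subspace of $\mathcal M$ and $\|\cdot\|_p^*$ is a norm on $\mathcal M_p$: for all $\mu,\sigma\in\mathcal M_p$ and $c\in\mathbb C$, $$\|\mu+\sigma\|_p^*\le\|\mu\|_p^*+\|\sigma\|_p^*,\qquad \|c\mu\|_p^*=|c|\,\|\mu\|_p^*,\qquad \|\mu\|_p^*=0\iff\mu=0 .$$ -/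

import Mathlib

open MeasureTheory
open scoped ENNReal SchwartzMap FourierTransform

noncomputable section

/-! ### Sigma-finite complex measures -/

/-- A polar form `dμ = φ d|μ|` of a sigma-finite complex measure: the total variation `|μ|` is a
positive sigma-finite measure (possibly infinite) and the phase `φ` has modulus one. -/
structure PolarForm (X : Type*) [MeasurableSpace X] where
  variation : Measure X
  sigmaFinite : SigmaFinite variation
  phase : X → ℂ
  measurable_phase : Measurable phase
  norm_phase : ∀ x, ‖phase x‖ = 1

attribute [instance] PolarForm.sigmaFinite

namespace PolarForm

variable {X : Type*} [MeasurableSpace X]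

/-- Two polar forms define the same measure iff they have the same total variation and
phases that agree almost everywhere for it. -/
instance setoid : Setoid (PolarForm X) where
  r P Q := P.variation = Q.variation ∧ P.phase =ᵐ[P.variation] Q.phase
  iseqv :=
    { refl := fun _ => ⟨rfl, Filter.EventuallyEq.rfl⟩
      symm := fun h => ⟨h.1.symm, h.1 ▸ h.2.symm⟩
      trans := fun h k => ⟨h.1.trans k.1, h.2.trans (h.1.symm ▸ k.2)⟩ }

lemma equiv_iff {P Q : PolarForm X} :
    P ≈ Q ↔ P.variation = Q.variation ∧ P.phase =ᵐ[P.variation] Q.phase := Iff.rfl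

/-- The normalization `z / |z|` (with value `1` at `z = 0`). -/
def unitPhase (z : ℂ) : ℂ := if z = 0 then 1 else z / (‖z‖ : ℂ)

lemma norm_unitPhase (z : ℂ) : ‖unitPhase z‖ = 1 := by
  unfold unitPhase
  split_ifs with h
  · simp
  · simp [h]

lemma measurable_unitPhase : Measurable unitPhase := by
  unfold unitPhase
  exact Measurable.ite (measurableSet_eq) measurable_const (by fun_prop)

lemma unitPhase_mul_norm (z : ℂ) : unitPhase z * (‖z‖ : ℂ) = z := by
  unfold unitPhase
  split_ifs with h
  · simp [h]
  · have : (‖z‖ : ℂ) ≠ 0 := by simpa using h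
    field_simp

lemma unitPhase_of_norm_eq_one {z : ℂ} (h : ‖z‖ = 1) : unitPhase z = z := by
  have := unitPhase_mul_norm z
  simpa [h] using this

lemma unitPhase_mul_pos (z : ℂ) {r : ℝ} (hr : 0 < r) : unitPhase (z * r) = unitPhase z := by
  unfold unitPhase
  by_cases hz : z = 0
  · simp [hz]
  · have h1 : (r : ℂ) ≠ 0 := by exact_mod_cast hr.ne'
    have h2 : (‖z‖ : ℂ) ≠ 0 := by simpa using hz
    simp only [mul_eq_zero, hz, h1, or_self, if_false, norm_mul, Complex.norm_real,
      Real.norm_eq_abs, abs_of_pos hr, Complex.ofReal_mul]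
    field_simp

/-- The polar form of the sigma-finite complex measure `g dν`. -/
def ofDensity (ν : Measure X) [SigmaFinite ν] (g : X → ℂ) (hg : Measurable g) : PolarForm X where
  variation := ν.withDensity fun x => ‖g x‖ₑ
  sigmaFinite := SigmaFinite.withDensity_of_ne_top' fun _ => enorm_ne_top
  phase x := unitPhase (g x)
  measurable_phase := measurable_unitPhase.comp hg
  norm_phase x := norm_unitPhase (g x)

/-- The density of `μ` with respect to a positive measure `ν` dominating `|μ|`. -/
def density (P : PolarForm X) (ν : Measure X) (x : X) : ℂ :=
  P.phase x * ((P.variation.rnDeriv ν x).toReal : ℂ)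

lemma measurable_density (P : PolarForm X) (ν : Measure X) : Measurable (P.density ν) := by
  have := P.measurable_phase
  unfold density
  fun_prop

/-- The sum of `μ` and `σ`: add the densities with respect to `|μ| + |σ|`. -/
def add (P Q : PolarForm X) : PolarForm X :=
  ofDensity (P.variation + Q.variation)
    (fun x => P.density (P.variation + Q.variation) x + Q.density (P.variation + Q.variation) x)
    ((P.measurable_density _).add (Q.measurable_density _))

/-- The scalar multiple `c μ`. -/
def smul (c : ℂ) (P : PolarForm X) : PolarForm X :=
  ofDensity P.variation (fun x => c * P.phase x) (P.measurable_phase.const_mul c)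

/-- The zero measure. -/
def zero : PolarForm X where
  variation := 0
  sigmaFinite := inferInstance
  phase _ := 1
  measurable_phase := measurable_const
  norm_phase _ := by simp

lemma ofDensity_congr {ν : Measure X} [SigmaFinite ν] {g g' : X → ℂ} (hg : Measurable g)
    (hg' : Measurable g') (h : g =ᵐ[ν] g') : ofDensity ν g hg ≈ ofDensity ν g' hg' := by
  refine equiv_iff.2 ⟨withDensity_congr_ae ?_, ?_⟩
  · filter_upwards [h] with x hx using by rw [hx]
  · refine (withDensity_absolutelyContinuous ν _).ae_le ?_
    filter_upwards [h] with x hx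
    simp [ofDensity, hx]

lemma ofDensity_phase (P : PolarForm X) :
    ofDensity P.variation P.phase P.measurable_phase ≈ P := by
  refine equiv_iff.2 ⟨?_, ?_⟩
  · have : (fun x => ‖P.phase x‖ₑ) = 1 := by
      ext x
      rw [← ofReal_norm, P.norm_phase]
      simp
    change P.variation.withDensity (fun x => ‖P.phase x‖ₑ) = _
    rw [this, withDensity_one]
  · exact Filter.Eventually.of_forall fun x => unitPhase_of_norm_eq_one (P.norm_phase x)

lemma ofDensity_change {ν κ : Measure X} [SigmaFinite ν] [SigmaFinite κ] (hνκ : ν ≪ κ)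
    {g : X → ℂ} (hg : Measurable g) :
    ofDensity ν g hg ≈ ofDensity κ (fun x => g x * ((ν.rnDeriv κ x).toReal : ℂ))
      (by fun_prop) := by
  refine equiv_iff.2 ⟨?_, ?_⟩
  · change ν.withDensity (fun x => ‖g x‖ₑ) =
      κ.withDensity (fun x => ‖g x * ((ν.rnDeriv κ x).toReal : ℂ)‖ₑ)
    conv_lhs => rw [← Measure.withDensity_rnDeriv_eq ν κ hνκ]
    rw [← withDensity_mul _ (Measure.measurable_rnDeriv ν κ) (by fun_prop)]
    refine withDensity_congr_ae ?_
    filter_upwards [Measure.rnDeriv_lt_top ν κ] with x hx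
    have : ‖((ν.rnDeriv κ x).toReal : ℂ)‖ₑ = ν.rnDeriv κ x := by
      rw [← ofReal_norm, Complex.norm_real, Real.norm_of_nonneg ENNReal.toReal_nonneg,
        ENNReal.ofReal_toReal hx.ne]
    simp [enorm_mul, this, mul_comm]
  · refine (withDensity_absolutelyContinuous ν _).ae_le ?_
    filter_upwards [Measure.rnDeriv_pos hνκ, hνκ.ae_le (Measure.rnDeriv_lt_top ν κ)] with x h0 h1
    exact (unitPhase_mul_pos (g x) (ENNReal.toReal_pos h0.ne' h1.ne)).symm

lemma equiv_ofDensity_density (P : PolarForm X) {κ : Measure X} [SigmaFinite κ]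
    (h : P.variation ≪ κ) : P ≈ ofDensity κ (P.density κ) (P.measurable_density κ) :=
  Setoid.trans (Setoid.symm P.ofDensity_phase) (ofDensity_change h P.measurable_phase)

lemma density_ofDensity {ν : Measure X} [SigmaFinite ν] {g : X → ℂ} (hg : Measurable g) :
    (ofDensity ν g hg).density ν =ᵐ[ν] g := by
  have h : (ofDensity ν g hg).variation.rnDeriv ν =ᵐ[ν] fun x => ‖g x‖ₑ :=
    Measure.rnDeriv_withDensity ν (by fun_prop)
  filter_upwards [h] with x hx
  simp only [density, hx]
  simpa [ofDensity] using unitPhase_mul_norm (g x)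

lemma density_congr {P Q : PolarForm X} (h : P ≈ Q) {κ : Measure X} [SigmaFinite κ]
    (hP : P.variation ≪ κ) : P.density κ =ᵐ[κ] Q.density κ := by
  obtain ⟨h1, h2⟩ := equiv_iff.1 h
  have h3 : ∀ᵐ x ∂κ, P.variation.rnDeriv κ x ≠ 0 → P.phase x = Q.phase x := by
    rw [← ae_withDensity_iff (Measure.measurable_rnDeriv _ _),
      Measure.withDensity_rnDeriv_eq _ _ hP]
    exact h2
  filter_upwards [h3] with x hx
  unfold density
  rw [← h1]
  by_cases h0 : P.variation.rnDeriv κ x = 0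
  · simp [h0]
  · rw [hx h0]

lemma density_mul_rnDeriv (P : PolarForm X) {ν κ : Measure X} [SigmaFinite ν] [SigmaFinite κ]
    (h : P.variation ≪ ν) :
    (fun x => P.density ν x * ((ν.rnDeriv κ x).toReal : ℂ)) =ᵐ[κ] P.density κ := by
  filter_upwards [Measure.rnDeriv_mul_rnDeriv (κ := κ) h] with x hx
  simp only [density, ← hx, Pi.mul_apply, ENNReal.toReal_mul, Complex.ofReal_mul, mul_assoc]

lemma add_equiv (P Q : PolarForm X) {κ : Measure X} [SigmaFinite κ] (hP : P.variation ≪ κ)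
    (hQ : Q.variation ≪ κ) :
    add P Q ≈ ofDensity κ (fun x => P.density κ x + Q.density κ x)
      ((P.measurable_density _).add (Q.measurable_density _)) := by
  refine Setoid.trans (ofDensity_change (κ := κ) (hP.add_left hQ) _) (ofDensity_congr _ _ ?_)
  have h1 : P.variation ≪ P.variation + Q.variation := by
    exact Measure.AbsolutelyContinuous.rfl.add_right _
  have h2 : Q.variation ≪ P.variation + Q.variation := by
    rw [add_comm]
    exact Measure.AbsolutelyContinuous.rfl.add_right _
  filter_upwards [P.density_mul_rnDeriv (κ := κ) h1, Q.density_mul_rnDeriv (κ := κ) h2]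
    with x hx hy
  rw [add_mul, hx, hy]

lemma add_congr {P P' Q Q' : PolarForm X} (h : P ≈ P') (k : Q ≈ Q') : add P Q ≈ add P' Q' := by
  have h1 : P.variation ≪ P.variation + Q.variation :=
    Measure.AbsolutelyContinuous.rfl.add_right _
  have h2 : Q.variation ≪ P.variation + Q.variation := by
    rw [add_comm]
    exact Measure.AbsolutelyContinuous.rfl.add_right _
  refine Setoid.trans (add_equiv P Q h1 h2) (Setoid.trans (ofDensity_congr _ ?_ ?_)
    (Setoid.symm (add_equiv P' Q' (κ := P.variation + Q.variation) ?_ ?_)))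
  · exact (P'.measurable_density _).add (Q'.measurable_density _)
  · filter_upwards [density_congr h h1, density_congr k h2] with x hx hy
    rw [hx, hy]
  · rwa [← (equiv_iff.1 h).1]
  · rwa [← (equiv_iff.1 k).1]

lemma add_ofDensity {κ : Measure X} [SigmaFinite κ] {g g' : X → ℂ} (hg : Measurable g)
    (hg' : Measurable g') :
    add (ofDensity κ g hg) (ofDensity κ g' hg') ≈
      ofDensity κ (fun x => g x + g' x) (hg.add hg') := by
  refine Setoid.trans (add_equiv _ _ (κ := κ) (withDensity_absolutelyContinuous _ _)
    (withDensity_absolutelyContinuous _ _)) (ofDensity_congr _ _ ?_)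
  filter_upwards [density_ofDensity (ν := κ) hg, density_ofDensity (ν := κ) hg'] with x hx hy
  rw [hx, hy]

lemma smul_congr (c : ℂ) {P Q : PolarForm X} (h : P ≈ Q) : smul c P ≈ smul c Q := by
  obtain ⟨v, hv, φ, hφ, hφ1⟩ := P
  obtain ⟨w, hw, ψ, hψ, hψ1⟩ := Q
  obtain ⟨h1, h2⟩ := equiv_iff.1 h
  simp only at h1 h2
  subst h1
  refine ofDensity_congr _ _ ?_
  filter_upwards [h2] with x hx
  rw [hx]

lemma smul_ofDensity (c : ℂ) {κ : Measure X} [SigmaFinite κ] {g : X → ℂ} (hg : Measurable g) :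
    smul c (ofDensity κ g hg) ≈ ofDensity κ (fun x => c * g x) (hg.const_mul c) := by
  refine Setoid.trans (ofDensity_change (κ := κ) (withDensity_absolutelyContinuous _ _) _)
    (ofDensity_congr _ _ ?_)
  filter_upwards [density_ofDensity (ν := κ) hg] with x hx
  rw [mul_assoc]
  exact congrArg (c * ·) hx

lemma zero_equiv {κ : Measure X} [SigmaFinite κ] :
    (zero : PolarForm X) ≈ ofDensity κ (fun _ => 0) measurable_const := by
  refine equiv_iff.2 ⟨?_, ?_⟩
  · simp [zero, ofDensity]
  · simp [zero, Filter.EventuallyEq]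

end PolarForm

/-- Sigma-finite complex measures on a measurable space. -/
def SigmaFiniteComplexMeasure (X : Type*) [MeasurableSpace X] : Type _ :=
  Quotient (PolarForm.setoid (X := X))

namespace SigmaFiniteComplexMeasure

variable {X : Type*} [MeasurableSpace X]

/-- The complex measure `g dν`. -/
def ofDensity (ν : Measure X) [SigmaFinite ν] (g : X → ℂ) (hg : Measurable g) :
    SigmaFiniteComplexMeasure X :=
  Quotient.mk _ (PolarForm.ofDensity ν g hg)

instance : Zero (SigmaFiniteComplexMeasure X) := ⟨Quotient.mk _ PolarForm.zero⟩

instance : Add (SigmaFiniteComplexMeasure X) :=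
  ⟨Quotient.map₂ PolarForm.add fun _ _ h _ _ k => PolarForm.add_congr h k⟩

instance : SMul ℂ (SigmaFiniteComplexMeasure X) :=
  ⟨fun c => Quotient.map (PolarForm.smul c) fun _ _ h => PolarForm.smul_congr c h⟩

instance : Neg (SigmaFiniteComplexMeasure X) := ⟨fun μ => (-1 : ℂ) • μ⟩

lemma ofDensity_add {κ : Measure X} [SigmaFinite κ] {g g' : X → ℂ} (hg : Measurable g)
    (hg' : Measurable g') :
    ofDensity κ g hg + ofDensity κ g' hg' = ofDensity κ (fun x => g x + g' x) (hg.add hg') :=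
  Quotient.sound (PolarForm.add_ofDensity hg hg')

lemma smul_ofDensity (c : ℂ) {κ : Measure X} [SigmaFinite κ] {g : X → ℂ} (hg : Measurable g) :
    c • ofDensity κ g hg = ofDensity κ (fun x => c * g x) (hg.const_mul c) :=
  Quotient.sound (PolarForm.smul_ofDensity c hg)

lemma zero_eq (κ : Measure X) [SigmaFinite κ] :
    (0 : SigmaFiniteComplexMeasure X) = ofDensity κ (fun _ => 0) measurable_const :=
  Quotient.sound PolarForm.zero_equiv

lemma neg_eq (μ : SigmaFiniteComplexMeasure X) : -μ = (-1 : ℂ) • μ := rfl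

/-- Any three sigma-finite complex measures have densities for a common positive measure. -/
lemma exists_density (μ σ τ : SigmaFiniteComplexMeasure X) :
    ∃ (κ : Measure X) (_ : SigmaFinite κ) (f g h : X → ℂ) (hf : Measurable f) (hg : Measurable g)
      (hh : Measurable h), μ = ofDensity κ f hf ∧ σ = ofDensity κ g hg ∧ τ = ofDensity κ h hh := by
  induction μ using Quotient.inductionOn with | _ P
  induction σ using Quotient.inductionOn with | _ Q
  induction τ using Quotient.inductionOn with | _ R
  have hP : P.variation ≪ P.variation + Q.variation + R.variation :=
    (Measure.AbsolutelyContinuous.rfl.add_right _).add_right _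
  have hQ : Q.variation ≪ P.variation + Q.variation + R.variation := by
    rw [add_comm P.variation]
    exact (Measure.AbsolutelyContinuous.rfl.add_right _).add_right _
  have hR : R.variation ≪ P.variation + Q.variation + R.variation := by
    rw [add_comm]
    exact Measure.AbsolutelyContinuous.rfl.add_right _
  exact ⟨_, inferInstance, _, _, _, _, _, _, Quotient.sound (P.equiv_ofDensity_density hP),
    Quotient.sound (Q.equiv_ofDensity_density hQ), Quotient.sound (R.equiv_ofDensity_density hR)⟩

instance : AddCommGroup (SigmaFiniteComplexMeasure X) where
  add_assoc μ σ τ := by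
    obtain ⟨κ, _, f, g, h, hf, hg, hh, rfl, rfl, rfl⟩ := exists_density μ σ τ
    simp only [ofDensity_add, add_assoc]
  zero_add μ := by
    obtain ⟨κ, _, f, g, h, hf, hg, hh, rfl, -, -⟩ := exists_density μ μ μ
    simp only [zero_eq κ, ofDensity_add, zero_add]
  add_zero μ := by
    obtain ⟨κ, _, f, g, h, hf, hg, hh, rfl, -, -⟩ := exists_density μ μ μ
    simp only [zero_eq κ, ofDensity_add, add_zero]
  add_comm μ σ := by
    obtain ⟨κ, _, f, g, h, hf, hg, hh, rfl, rfl, -⟩ := exists_density μ σ σ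
    simp only [ofDensity_add, add_comm]
  neg_add_cancel μ := by
    obtain ⟨κ, _, f, g, h, hf, hg, hh, rfl, -, -⟩ := exists_density μ μ μ
    simp only [zero_eq κ, neg_eq, smul_ofDensity, ofDensity_add, neg_mul, one_mul, neg_add_cancel]
  nsmul := nsmulRec
  zsmul := zsmulRec

instance : Module ℂ (SigmaFiniteComplexMeasure X) where
  one_smul μ := by
    obtain ⟨κ, _, f, g, h, hf, hg, hh, rfl, -, -⟩ := exists_density μ μ μ
    simp only [smul_ofDensity, one_mul]
  mul_smul a b μ := by
    obtain ⟨κ, _, f, g, h, hf, hg, hh, rfl, -, -⟩ := exists_density μ μ μ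
    simp only [smul_ofDensity, mul_assoc]
  smul_zero a := by
    simp only [zero_eq (0 : Measure X), smul_ofDensity, mul_zero]
  smul_add a μ σ := by
    obtain ⟨κ, _, f, g, h, hf, hg, hh, rfl, rfl, -⟩ := exists_density μ σ σ
    simp only [smul_ofDensity, ofDensity_add, mul_add]
  add_smul a b μ := by
    obtain ⟨κ, _, f, g, h, hf, hg, hh, rfl, -, -⟩ := exists_density μ μ μ
    simp only [smul_ofDensity, ofDensity_add, add_mul]
  zero_smul μ := by
    obtain ⟨κ, _, f, g, h, hf, hg, hh, rfl, -, -⟩ := exists_density μ μ μ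
    simp only [zero_eq κ, smul_ofDensity, zero_mul]

/-- The total variation `|μ|`. -/
def variation (μ : SigmaFiniteComplexMeasure X) : Measure X :=
  Quotient.lift PolarForm.variation (fun _ _ h => (PolarForm.equiv_iff.1 h).1) μ

/-- The integral `∫ h dμ`, meaningful when `h` is integrable for `|μ|`. -/
def integral (μ : SigmaFiniteComplexMeasure X) (h : X → ℂ) : ℂ :=
  Quotient.lift (fun P : PolarForm X => ∫ x, h x * P.phase x ∂P.variation)
    (fun P Q hPQ => by
      obtain ⟨h1, h2⟩ := PolarForm.equiv_iff.1 hPQ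
      simp only [← h1]
      refine integral_congr_ae ?_
      filter_upwards [h2] with x hx
      rw [hx]) μ

lemma variation_ofDensity (ν : Measure X) [SigmaFinite ν] (g : X → ℂ) (hg : Measurable g) :
    (ofDensity ν g hg).variation = ν.withDensity fun x => ‖g x‖ₑ := rfl

lemma integral_ofDensity (ν : Measure X) [SigmaFinite ν] (g : X → ℂ) (hg : Measurable g)
    (h : X → ℂ) : (ofDensity ν g hg).integral h = ∫ x, h x * g x ∂ν := by
  change ∫ x, h x * PolarForm.unitPhase (g x) ∂(ν.withDensity fun x => ‖g x‖ₑ) = _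
  rw [integral_withDensity_eq_integral_toReal_smul (by fun_prop)
    (Filter.Eventually.of_forall fun _ => enorm_lt_top)]
  refine integral_congr_ae (Filter.Eventually.of_forall fun x => ?_)
  simp only [toReal_enorm, Complex.real_smul]
  rw [mul_left_comm, mul_comm (‖g x‖ : ℂ), PolarForm.unitPhase_mul_norm]

/-- `|∫ h dμ|` as an extended number, equal to `∞` if `h` is not integrable for `|μ|`. -/
def absIntegral (h : X → ℂ) (μ : SigmaFiniteComplexMeasure X) : ℝ≥0∞ :=
  open Classical in if Integrable h μ.variation then ‖μ.integral h‖ₑ else ∞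

end SigmaFiniteComplexMeasure

/-! ### The spaces `L̂^q` and the dual norms -/

/-- `f` is the Fourier transform of `g` in the sense of distributions:
`∫ f ψ = ∫ g ψ̂` for all Schwartz functions `ψ`. -/
def IsFourierTransform {n : ℕ} (g f : EuclideanSpace ℝ (Fin n) → ℂ) : Prop :=
  ∀ ψ : 𝓢(EuclideanSpace ℝ (Fin n), ℂ), ∫ x, f x * ψ x = ∫ x, g x * 𝓕 ψ x

/-- `f ∈ L̂^q(ℝⁿ)`: `f ∈ L^q` and `f` is the Fourier transform of a function in `L^{q'}`. -/
def MemHatLp {n : ℕ} (f : EuclideanSpace ℝ (Fin n) → ℂ) (q : ℝ≥0∞) : Prop :=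
  MemLp f q volume ∧
    ∃ g : EuclideanSpace ℝ (Fin n) → ℂ, MemLp g q.conjExponent volume ∧ IsFourierTransform g f

/-- The norm `‖f‖_{L̂^q} = ‖f̂‖_{q'}`. The Fourier transform of `f ∈ L̂^q` is the almost everywhere
unique function `k ∈ L^{q'}` that represents it, so that the infimum has a single value. -/
def hatNorm {n : ℕ} (f : EuclideanSpace ℝ (Fin n) → ℂ) (q : ℝ≥0∞) : ℝ≥0∞ :=
  ⨅ (k : EuclideanSpace ℝ (Fin n) → ℂ) (_ : MemLp k q.conjExponent volume)
    (_ : IsFourierTransform f k), eLpNorm k q.conjExponent volume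

/-- The functional `‖μ‖_p^*`: the supremum of `|∫ h dμ|` over the (continuous) functions `h` in the
unit ball of `L̂^{p'}`. Continuity gives `h` definite values on Lebesgue null sets, which a singular
measure `μ` may charge. -/
def dualNorm {n : ℕ} (p : ℝ≥0∞) (μ : SigmaFiniteComplexMeasure (EuclideanSpace ℝ (Fin n))) :
    ℝ≥0∞ :=
  ⨆ (h : EuclideanSpace ℝ (Fin n) → ℂ) (_ : Continuous h) (_ : MemHatLp h p.conjExponent)
    (_ : hatNorm h p.conjExponent ≤ 1), μ.absIntegral h

/-- The space `𝓜_p` of sigma-finite complex Borel measures on `ℝⁿ` with `‖μ‖_p^* < ∞`. -/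
def measureSpaceM (n : ℕ) (p : ℝ≥0∞) :
    Set (SigmaFiniteComplexMeasure (EuclideanSpace ℝ (Fin n))) :=
  {μ | dualNorm p μ < ∞}

end

open scoped ComplexConjugate

/-! ### Integration against a sigma-finite complex measure -/

namespace SigmaFiniteComplexMeasure

variable {X : Type*} [MeasurableSpace X]

/-! Subadditivity and homogeneity already hold for each fixed `h`: finitely many sigma-finite
complex measures have densities for one positive measure `κ`, and `∫ h dμ` becomes an ordinary
integral that is linear in the density. The value `∞` for non-integrable `h` is compatible with both
(`absIntegral_add_le`, `absIntegral_smul`), so both pass to the supremum, and with them the subspace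
property.

Definiteness rests on Schwartz functions. They are continuous and lie in every `L̂^q` with finite
norm, so a nonzero multiple of each enters the unit ball. If the dual norm of `μ` vanishes, every
Schwartz function is therefore integrable for `|μ|` and has integral zero. Integrability of bump
functions makes `|μ|` locally finite, hence the phase `φ` is locally integrable. The fundamental
lemma of the calculus of variations (`ae_eq_zero_of_integral_contDiff_smul_eq_zero`) then gives `φ =
0` almost everywhere for `|μ|`; since `|φ| = 1`, this forces `|μ| = 0`. -/

/-- The variation has density `|f|`, and `f = u |f|` with `u` unimodular. Multiplication by the
bounded functions `u` and `conj u` passes between `h |f|` and `h f`. -/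
lemma integrable_variation_ofDensity {κ : Measure X} [SigmaFinite κ] {f : X → ℂ}
    (hf : Measurable f) {h : X → ℂ} :
    Integrable h (ofDensity κ f hf).variation ↔ Integrable (fun x => h x * f x) κ := by
  have hu : Measurable fun x => PolarForm.unitPhase (f x) := PolarForm.measurable_unitPhase.comp hf
  rw [variation_ofDensity, integrable_withDensity_iff_integrable_smul' (by fun_prop)
    (Filter.Eventually.of_forall fun _ => enorm_lt_top)]
  simp only [toReal_enorm, Complex.real_smul]
  constructor <;> intro H
  · refine (H.bdd_mul (c := 1) hu.aestronglyMeasurable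
      (.of_forall fun x => (PolarForm.norm_unitPhase _).le)).congr (.of_forall fun x => ?_)
    dsimp only
    rw [← mul_assoc, PolarForm.unitPhase_mul_norm, mul_comm]
  · refine (H.bdd_mul (c := 1) (f := fun x => conj (PolarForm.unitPhase (f x)))
      (Complex.continuous_conj.measurable.comp hu).aestronglyMeasurable
      (.of_forall fun x => by
        rw [RCLike.norm_conj]; exact (PolarForm.norm_unitPhase _).le)).congr
      (.of_forall fun x => ?_)
    have h1 : conj (PolarForm.unitPhase (f x)) * PolarForm.unitPhase (f x) = 1 := by
      rw [Complex.conj_mul', PolarForm.norm_unitPhase]; simp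
    dsimp only
    nth_rewrite 2 [← PolarForm.unitPhase_mul_norm (f x)]
    linear_combination (‖f x‖ : ℂ) * h x * h1

lemma absIntegral_of_integrable {μ : SigmaFiniteComplexMeasure X} {h : X → ℂ}
    (H : Integrable h μ.variation) : absIntegral h μ = ‖μ.integral h‖ₑ := if_pos H

lemma absIntegral_of_not_integrable {μ : SigmaFiniteComplexMeasure X} {h : X → ℂ}
    (H : ¬ Integrable h μ.variation) : absIntegral h μ = ∞ := if_neg H

lemma integrable_of_absIntegral_ne_top {μ : SigmaFiniteComplexMeasure X} {h : X → ℂ}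
    (H : absIntegral h μ ≠ ∞) : Integrable h μ.variation :=
  not_not.1 fun hn => H (absIntegral_of_not_integrable hn)

/-- Cancellation in `μ + σ` may make `h` integrable for the sum but not for the summands; the right
side is then `∞`. Otherwise this is the triangle inequality for integrals over a common `κ`. -/
lemma absIntegral_add_le (h : X → ℂ) (μ σ : SigmaFiniteComplexMeasure X) :
    absIntegral h (μ + σ) ≤ absIntegral h μ + absIntegral h σ := by
  by_cases hμ : Integrable h μ.variation
  swap
  · simp [absIntegral_of_not_integrable hμ]
  by_cases hσ : Integrable h σ.variation
  swap
  · simp [absIntegral_of_not_integrable hσ]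
  obtain ⟨κ, _, f, g, -, hf, hg, -, rfl, rfl, -⟩ := exists_density μ σ σ
  have h1 := (integrable_variation_ofDensity hf).1 hμ
  have h2 := (integrable_variation_ofDensity hg).1 hσ
  rw [ofDensity_add, absIntegral_of_integrable hμ, absIntegral_of_integrable hσ,
    absIntegral_of_integrable, integral_ofDensity, integral_ofDensity, integral_ofDensity]
  · simp only [mul_add]
    rw [integral_add h1 h2]
    exact enorm_add_le _ _
  · rw [integrable_variation_ofDensity]
    simp only [mul_add]
    exact h1.add h2

lemma absIntegral_zero (h : X → ℂ) : absIntegral h (0 : SigmaFiniteComplexMeasure X) = 0 := by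
  rw [zero_eq (0 : Measure X), absIntegral_of_integrable, integral_ofDensity]
  · simp
  · rw [integrable_variation_ofDensity]
    simp

/-- As `c` is invertible, `h` is integrable for `|c μ|` exactly when it is for `|μ|`, so the two
sides are infinite together. -/
lemma absIntegral_smul {c : ℂ} (hc : c ≠ 0) (h : X → ℂ) (μ : SigmaFiniteComplexMeasure X) :
    absIntegral h (c • μ) = ‖c‖ₑ * absIntegral h μ := by
  obtain ⟨κ, _, f, -, -, hf, -, -, rfl, -, -⟩ := exists_density μ μ μ
  have key : Integrable h (c • ofDensity κ f hf).variation ↔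
      Integrable h (ofDensity κ f hf).variation := by
    rw [smul_ofDensity, integrable_variation_ofDensity, integrable_variation_ofDensity]
    simp only [mul_left_comm _ c]
    exact integrable_const_mul_iff (IsUnit.mk0 c hc) _
  by_cases H : Integrable h (ofDensity κ f hf).variation
  · rw [absIntegral_of_integrable H, absIntegral_of_integrable (key.2 H), smul_ofDensity,
      integral_ofDensity, integral_ofDensity]
    simp only [mul_left_comm _ c]
    rw [integral_const_mul, enorm_mul]
  · rw [absIntegral_of_not_integrable H, absIntegral_of_not_integrable (fun h => H (key.1 h)),
      ENNReal.mul_top (enorm_ne_zero.2 hc)]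

lemma eq_zero_of_variation_eq_zero {μ : SigmaFiniteComplexMeasure X} (h : μ.variation = 0) :
    μ = 0 := by
  induction μ using Quotient.inductionOn with | _ P
  replace h : P.variation = 0 := h
  refine Quotient.sound (PolarForm.equiv_iff.2 ⟨h, ?_⟩)
  rw [h]
  exact ae_zero.symm ▸ Filter.eventually_bot

/-- A sigma-finite complex measure that integrates every test function to zero vanishes. -/
lemma eq_zero_of_integral_contDiff_eq_zero {E : Type*} [NormedAddCommGroup E] [NormedSpace ℝ E]
    [FiniteDimensional ℝ E] [MeasurableSpace E] [BorelSpace E] {μ : SigmaFiniteComplexMeasure E}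
    (H : ∀ g : E → ℝ, ContDiff ℝ (⊤ : ℕ∞) g → HasCompactSupport g →
      Integrable (fun x => (g x : ℂ)) μ.variation ∧ μ.integral (fun x => (g x : ℂ)) = 0) :
    μ = 0 := by
  apply eq_zero_of_variation_eq_zero
  induction μ using Quotient.inductionOn with | _ P
  change P.variation = 0
  -- Sigma-finiteness does not give this. A bump function equal to `1` on the unit ball around `x`
  -- is integrable, so by Markov's inequality that ball has finite measure.
  have hfin : IsLocallyFiniteMeasure P.variation := by
    refine ⟨fun x => ⟨Metric.closedBall x 1, Metric.closedBall_mem_nhds x one_pos, ?_⟩⟩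
    let b : ContDiffBump x := ⟨1, 2, one_pos, one_lt_two⟩
    have hb : Integrable (fun y => (b y : ℂ)) P.variation :=
      (H b b.contDiff b.hasCompactSupport).1
    refine (measure_mono fun y hy => ?_).trans_lt (hb.measure_norm_ge_lt_top one_pos)
    simp [b.one_of_mem_closedBall hy]
  have hloc : LocallyIntegrable P.phase P.variation := by
    refine (locallyIntegrable_const (1 : ℂ)).mono P.measurable_phase.aestronglyMeasurable ?_
    exact .of_forall fun x => by simp [P.norm_phase]
  have h0 := ae_eq_zero_of_integral_contDiff_smul_eq_zero hloc fun g hg hc => by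
    simp only [Complex.real_smul]
    exact (H g hg hc).2
  -- The phase is almost everywhere both zero and of modulus one, so `False` holds almost
  -- everywhere, which only the zero measure allows.
  refine ae_eq_bot.1 (Filter.eventually_false_iff_eq_bot.1 ?_)
  filter_upwards [h0] with x hx
  simpa [hx] using P.norm_phase x

end SigmaFiniteComplexMeasure

/-! ### Schwartz functions in `L̂^q` and the dual norm -/

section HatLp

variable {n : ℕ} {p : ℝ≥0∞}

lemma isFourierTransform_schwartz (f : 𝓢(EuclideanSpace ℝ (Fin n), ℂ)) :
    IsFourierTransform f ⇑(𝓕 f : 𝓢(EuclideanSpace ℝ (Fin n), ℂ)) := fun ψ => SchwartzMap.integral_fourier_mul_eq f ψ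

lemma memHatLp_schwartz (f : 𝓢(EuclideanSpace ℝ (Fin n), ℂ)) (q : ℝ≥0∞) : MemHatLp f q := by
  refine ⟨f.memLp q, ⇑(𝓕⁻ f : 𝓢(EuclideanSpace ℝ (Fin n), ℂ)), (𝓕⁻ f).memLp _, ?_⟩
  simpa using isFourierTransform_schwartz (𝓕⁻ f)

/-- Since `hatNorm` is an infimum, exhibiting one representative bounds it; uniqueness of the
transform plays no role. -/
lemma hatNorm_schwartz_le (f : 𝓢(EuclideanSpace ℝ (Fin n), ℂ)) (q : ℝ≥0∞) :
    hatNorm f q ≤ eLpNorm ⇑(𝓕 f : 𝓢(EuclideanSpace ℝ (Fin n), ℂ)) q.conjExponent volume :=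
  iInf_le_of_le ⇑(𝓕 f : 𝓢(EuclideanSpace ℝ (Fin n), ℂ))
    (iInf₂_le_of_le ((𝓕 f).memLp _) (isFourierTransform_schwartz f) le_rfl)

lemma exists_hatNorm_smul_schwartz_le_one (f : 𝓢(EuclideanSpace ℝ (Fin n), ℂ)) (q : ℝ≥0∞) :
    ∃ c : ℂ, c ≠ 0 ∧ hatNorm (c • f) q ≤ 1 := by
  have hC := ((𝓕 f).memLp q.conjExponent volume).2.ne
  set C := eLpNorm ⇑(𝓕 f : 𝓢(EuclideanSpace ℝ (Fin n), ℂ)) q.conjExponent volume with hCdef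
  have hpos : 0 < C.toReal + 1 := by positivity
  -- Scaling by `1 / (C + 1)` rather than `1 / C` covers `C = 0`, and `C / (C + 1) ≤ 1`.
  refine ⟨((C.toReal + 1)⁻¹ : ℝ), by exact_mod_cast (inv_pos.2 hpos).ne', ?_⟩
  refine (hatNorm_schwartz_le ((((C.toReal + 1)⁻¹ : ℝ) : ℂ) • f) q).trans ?_
  have h1 : ⇑(𝓕 ((((C.toReal + 1)⁻¹ : ℝ) : ℂ) • f) : 𝓢(EuclideanSpace ℝ (Fin n), ℂ)) =
      (((C.toReal + 1)⁻¹ : ℝ) : ℂ) • ⇑(𝓕 f : 𝓢(EuclideanSpace ℝ (Fin n), ℂ)) := by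
    rw [FourierTransform.fourier_smul]; rfl
  rw [h1, eLpNorm_const_smul, ← hCdef, ← ofReal_norm, Complex.norm_real,
    Real.norm_of_nonneg (inv_pos.2 hpos).le]
  nth_rewrite 2 [← ENNReal.ofReal_toReal hC]
  rw [← ENNReal.ofReal_mul (inv_pos.2 hpos).le, ENNReal.ofReal_le_one, inv_mul_le_iff₀ hpos]
  linarith

lemma absIntegral_le_dualNorm {h : EuclideanSpace ℝ (Fin n) → ℂ} (hc : Continuous h)
    (hm : MemHatLp h p.conjExponent) (hn : hatNorm h p.conjExponent ≤ 1)
    (μ : SigmaFiniteComplexMeasure (EuclideanSpace ℝ (Fin n))) :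
    μ.absIntegral h ≤ dualNorm p μ :=
  le_iSup_of_le h (le_iSup_of_le hc (le_iSup₂_of_le hm hn le_rfl))

lemma dualNorm_zero (p : ℝ≥0∞) :
    dualNorm p (0 : SigmaFiniteComplexMeasure (EuclideanSpace ℝ (Fin n))) = 0 := by
  simp [dualNorm, SigmaFiniteComplexMeasure.absIntegral_zero]

lemma dualNorm_add_le (μ σ : SigmaFiniteComplexMeasure (EuclideanSpace ℝ (Fin n))) :
    dualNorm p (μ + σ) ≤ dualNorm p μ + dualNorm p σ :=
  iSup_le fun h => iSup_le fun hc => iSup₂_le fun hm hn =>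
    (SigmaFiniteComplexMeasure.absIntegral_add_le h μ σ).trans
      (add_le_add (absIntegral_le_dualNorm hc hm hn μ) (absIntegral_le_dualNorm hc hm hn σ))

lemma dualNorm_smul (c : ℂ) (μ : SigmaFiniteComplexMeasure (EuclideanSpace ℝ (Fin n))) :
    dualNorm p (c • μ) = ‖c‖ₑ * dualNorm p μ := by
  -- For `c = 0` the dual norm of `μ` may be infinite; the convention `0 * ∞ = 0` keeps the identity
  -- true.
  rcases eq_or_ne c 0 with rfl | hc
  · simp [dualNorm_zero]
  · simp only [dualNorm, SigmaFiniteComplexMeasure.absIntegral_smul hc, ENNReal.mul_iSup]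

lemma eq_zero_of_dualNorm_eq_zero {μ : SigmaFiniteComplexMeasure (EuclideanSpace ℝ (Fin n))}
    (hμ : dualNorm p μ = 0) : μ = 0 := by
  have key (f : 𝓢(EuclideanSpace ℝ (Fin n), ℂ)) :
      Integrable f μ.variation ∧ μ.integral f = 0 := by
    obtain ⟨c, hc, hn⟩ := exists_hatNorm_smul_schwartz_le_one f p.conjExponent
    have h0 : μ.absIntegral (c • f) = 0 := by
      refine le_antisymm (hμ ▸ absIntegral_le_dualNorm (c • f).continuous
        (memHatLp_schwartz (c • f) _) hn μ) bot_le
    -- A vanishing `absIntegral` yields integrability too, because non-integrable functions receive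
    -- the value `∞`.
    have hi := SigmaFiniteComplexMeasure.integrable_of_absIntegral_ne_top (h0 ▸ ENNReal.zero_ne_top)
    refine ⟨(integrable_const_mul_iff (IsUnit.mk0 c hc) _).1 hi, ?_⟩
    rw [SigmaFiniteComplexMeasure.absIntegral_of_integrable hi, enorm_eq_zero] at h0
    -- A density turns the integral into an ordinary one, from which the scaling factor `c` can be
    -- pulled out and cancelled.
    obtain ⟨κ, _, d, -, -, hd, -, -, rfl, -, -⟩ :=
      SigmaFiniteComplexMeasure.exists_density μ μ μ
    rw [SigmaFiniteComplexMeasure.integral_ofDensity] at h0 ⊢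
    have h1 : ∫ x, c * (f x * d x) ∂κ = 0 := by
      simpa only [smul_apply, smul_eq_mul, mul_assoc] using h0
    rw [integral_const_mul] at h1
    exact (mul_eq_zero.1 h1).resolve_left hc
  refine SigmaFiniteComplexMeasure.eq_zero_of_integral_contDiff_eq_zero fun g hg hc => ?_
  -- A smooth compactly supported real function, viewed as complex-valued, is a Schwartz function.
  exact key ((hc.comp_left (g := ((↑) : ℝ → ℂ)) Complex.ofReal_zero).toSchwartzMap
    (Complex.ofRealCLM.contDiff.comp hg))

end HatLp

theorem mainTheorem7 (n : ℕ) (p : ℝ≥0∞) (hp : 1 ≤ p) :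
    (∃ V : Submodule ℂ (SigmaFiniteComplexMeasure (EuclideanSpace ℝ (Fin n))),
      (V : Set (SigmaFiniteComplexMeasure (EuclideanSpace ℝ (Fin n)))) = measureSpaceM n p) ∧
    (∀ μ ∈ measureSpaceM n p, ∀ σ ∈ measureSpaceM n p,
      dualNorm p (μ + σ) ≤ dualNorm p μ + dualNorm p σ) ∧
    (∀ c : ℂ, ∀ μ ∈ measureSpaceM n p, dualNorm p (c • μ) = ‖c‖ₑ * dualNorm p μ) ∧
    (∀ μ ∈ measureSpaceM n p, dualNorm p μ = 0 ↔ μ = 0) := by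
  refine ⟨⟨{ carrier := measureSpaceM n p, add_mem' := ?_, zero_mem' := ?_, smul_mem' := ?_ }, rfl⟩,
    fun μ _ σ _ => dualNorm_add_le μ σ, fun c μ _ => dualNorm_smul c μ,
    fun μ _ => ⟨eq_zero_of_dualNorm_eq_zero, fun h => h ▸ dualNorm_zero p⟩⟩
  · exact fun hμ hσ => (dualNorm_add_le _ _).trans_lt (ENNReal.add_lt_top.2 ⟨hμ, hσ⟩)
  · exact (dualNorm_zero p).trans_lt ENNReal.zero_lt_top
  · exact fun c μ hμ => (dualNorm_smul c μ).trans_lt (ENNReal.mul_lt_top enorm_lt_top hμ)
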